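/- Let $n\ge 2$ and let $\Omega\subset\mathbb{C}^n$ be a bounded convex domain (a nonempty open set) with $C^\infty$-smooth boundary. Let $\phi=(\phi_1,\dots,\phi_n):\Omega\to\Omega$ be a holomorphic map all of whose components are $C^1$-smooth up to the boundary, that is, $\phi_j\in C^1(\overline\Omega)$ for $j=1,\dots,n$. Let $A^2(\Omega)$ be the Bergman space of all holomorphic functions $f:\Omega\to\mathbb{C}$ with $\|f\|^2=\int_\Omega |f|^2\,dV<\infty$, where $V$ is Lebesgue measure, and let $C_\phi f=f\circ\phi$ for $f\in A^2(\Omega)$. If $\phi:\Omega\to\Omega$ is proper and surjective, then $C_\phi$ is not compact on $A^2(\Omega)$; that is, it is not the case that $C_\phi$ maps $A^2(\Omega)$ into itself and is a compact linear operator there. -/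

import Mathlib

open MeasureTheory Set Topology
open scoped ContDiff

noncomputable section

namespace CompOp

/-- `ℂⁿ`, with the product topology and Lebesgue measure as `volume`. Only the topology, the
linear structure and Lebesgue measure are used below, so the choice of norm is immaterial. -/
abbrev Cn (n : ℕ) : Type := Fin n → ℂ

variable {n : ℕ}

/-- `Ω` has a `C^∞`-smooth boundary: near every boundary point `p` it is `{ρ < 0}` for a
real-valued `C^∞` function `ρ` with `dρ(p) ≠ 0`. -/
def HasSmoothBoundary (Ω : Set (Cn n)) : Prop :=
  ∀ p ∈ frontier Ω, ∃ (U : Set (Cn n)) (ρ : Cn n → ℝ),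
    IsOpen U ∧ p ∈ U ∧ ContDiffOn ℝ ∞ ρ U ∧ fderiv ℝ ρ p ≠ 0 ∧ Ω ∩ U = {z ∈ U | ρ z < 0}

/-- The Bergman space `A²(Ω)`: the elements of `L²(Ω)` that are (represented by) functions
holomorphic on `Ω`, with the norm of `L²(Ω)`. -/
def bergmanSpace (Ω : Set (Cn n)) : Submodule ℂ (Lp ℂ 2 (volume.restrict Ω)) where
  carrier := {f | ∃ g : Cn n → ℂ, DifferentiableOn ℂ g Ω ∧ f =ᵐ[volume.restrict Ω] g}
  add_mem' := by
    rintro f₁ f₂ ⟨g₁, hg₁, h₁⟩ ⟨g₂, hg₂, h₂⟩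
    exact ⟨g₁ + g₂, hg₁.add hg₂, (Lp.coeFn_add f₁ f₂).trans (h₁.add h₂)⟩
  zero_mem' := ⟨0, differentiableOn_const 0, Lp.coeFn_zero _ _ _⟩
  smul_mem' := by
    rintro c f ⟨g, hg, h⟩
    exact ⟨c • g, hg.const_smul c, (Lp.coeFn_smul c f).trans (h.const_smul c)⟩

variable {Ω : Set (Cn n)}

/-- The holomorphic function on `Ω` that an element of `A²(Ω)` is. Its values on `Ω` are uniquely
determined when `Ω` is open (`holo_eqOn`); its values off `Ω` are irrelevant. -/
def holo (f : bergmanSpace Ω) : Cn n → ℂ := f.2.choose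

theorem holo_differentiableOn (f : bergmanSpace Ω) : DifferentiableOn ℂ (holo f) Ω :=
  f.2.choose_spec.1

theorem holo_ae_eq (f : bergmanSpace Ω) :
    (f : Lp ℂ 2 (volume.restrict Ω)) =ᵐ[volume.restrict Ω] holo f :=
  f.2.choose_spec.2

theorem holo_eqOn (hΩ : IsOpen Ω) (f : bergmanSpace Ω) {g : Cn n → ℂ}
    (hg : DifferentiableOn ℂ g Ω)
    (hfg : (f : Lp ℂ 2 (volume.restrict Ω)) =ᵐ[volume.restrict Ω] g) : EqOn (holo f) g Ω :=
  Measure.eqOn_open_of_ae_eq ((holo_ae_eq f).symm.trans hfg) hΩ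
    (holo_differentiableOn f).continuousOn hg.continuousOn

/-- `f ∘ φ` is square integrable on `Ω` for every `f ∈ A²(Ω)`, that is, for a holomorphic self-map
`φ` of `Ω`, the composition operator `C_φ` maps `A²(Ω)` into `A²(Ω)`. -/
def ComposesBergman (Ω : Set (Cn n)) (φ : Cn n → Cn n) : Prop :=
  ∀ f : bergmanSpace Ω, MemLp (holo f ∘ φ) 2 (volume.restrict Ω)

/-- The composition operator `C_φ f = f ∘ φ` on `A²(Ω)`, for a holomorphic self-map `φ` of the open
set `Ω` such that `f ∘ φ ∈ A²(Ω)` for all `f ∈ A²(Ω)`. -/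
def compositionOperator {φ : Cn n → Cn n} (hΩ : IsOpen Ω) (hφ : DifferentiableOn ℂ φ Ω)
    (hmaps : MapsTo φ Ω Ω) (h : ComposesBergman Ω φ) : bergmanSpace Ω →ₗ[ℂ] bergmanSpace Ω where
  toFun f := ⟨(h f).toLp (holo f ∘ φ),
    holo f ∘ φ, (holo_differentiableOn f).comp hφ hmaps, (h f).coeFn_toLp⟩
  map_add' f₁ f₂ := by
    refine Subtype.ext ?_
    change (h (f₁ + f₂)).toLp _ = (h f₁).toLp _ + (h f₂).toLp _
    rw [← MemLp.toLp_add, MemLp.toLp_eq_toLp_iff]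
    have key : EqOn (holo (f₁ + f₂)) (holo f₁ + holo f₂) Ω :=
      holo_eqOn hΩ _ ((holo_differentiableOn f₁).add (holo_differentiableOn f₂))
        ((Lp.coeFn_add _ _).trans ((holo_ae_eq f₁).add (holo_ae_eq f₂)))
    exact (ae_restrict_mem hΩ.measurableSet).mono fun z hz => key (hmaps hz)
  map_smul' c f := by
    refine Subtype.ext ?_
    change (h (c • f)).toLp _ = c • (h f).toLp _
    rw [← MemLp.toLp_const_smul, MemLp.toLp_eq_toLp_iff]
    have key : EqOn (holo (c • f)) (c • holo f) Ω :=
      holo_eqOn hΩ _ ((holo_differentiableOn f).const_smul c)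
        ((Lp.coeFn_smul _ _).trans ((holo_ae_eq f).const_smul c))
    exact (ae_restrict_mem hΩ.measurableSet).mono fun z hz => key (hmaps hz)

end CompOp

end

/- A bounded Jacobian makes `C_φ` bounded below: as `φ` maps `Ω` onto itself, the area formula gives
`∫_Ω |f|² ≤ M ∫_Ω |f ∘ φ|²` when `|det Dφ| ≤ M`. A compact operator that is bounded below has a
precompact neighbourhood of the origin in its domain, so `A²(Ω)` would be finite-dimensional, while
it contains all polynomials in one coordinate. For `φ` of class `C¹` on the compact set `closure Ω`
the Jacobian is bounded on `Ω`. -/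

open scoped ENNReal NNReal Polynomial

namespace CompOp

theorem finiteDimensional_of_isCompactOperator_of_antilipschitzWith {𝕜 E F : Type*}
    [NontriviallyNormedField 𝕜] [CompleteSpace 𝕜] [NormedAddCommGroup E] [NormedSpace 𝕜 E]
    [NormedAddCommGroup F] [NormedSpace 𝕜 F] {T : E →ₗ[𝕜] F} {K : ℝ≥0}
    (hT : IsCompactOperator T) (hK : AntilipschitzWith K T) : FiniteDimensional 𝕜 E := by
  have hT_unif : UniformContinuous T := uniformContinuous_addMonoidHom_of_continuous hT.continuous
  obtain ⟨S, hS, hTS⟩ := hT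
  exact .of_totallyBounded_nhds_zero 𝕜 hTS
    (totallyBounded_preimage (hK.isUniformInducing hT_unif) hS.totallyBounded)

section Derivative

variable {𝕜 E F : Type*} [NontriviallyNormedField 𝕜] [NormedAddCommGroup E] [NormedSpace 𝕜 E]
  [NormedAddCommGroup F] [NormedSpace 𝕜 F] {f : E → F} {s : Set E}

theorem exists_mem_nhdsWithin_isBounded_fderiv_image {x : E} (hx : x ∈ s)
    (hf : ContDiffWithinAt 𝕜 1 f s x) :
    ∃ t ∈ 𝓝[s] x, Bornology.IsBounded (fderiv 𝕜 f '' (t ∩ interior s)) := by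
  obtain ⟨u, hu, -, -, f', hf', hf'_cont⟩ :=
    (contDiffWithinAt_succ_iff_hasFDerivWithinAt' (n := 0) (by simp)).1 (by simpa using hf)
  rw [insert_eq_of_mem hx] at hu
  have hball : f' ⁻¹' Metric.ball (f' x) 1 ∈ 𝓝[s] x :=
    hf'_cont.continuousWithinAt (Metric.ball_mem_nhds _ one_pos)
  refine ⟨_, Filter.inter_mem hu hball,
    (Metric.isBounded_ball (x := f' x) (r := 1)).subset ?_⟩
  rintro _ ⟨y, ⟨⟨hyu, hy_ball⟩, hys⟩, rfl⟩
  have hfy : fderiv 𝕜 f y = f' y :=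
    ((hf' y hyu).hasFDerivAt (mem_interior_iff_mem_nhds.1 hys)).fderiv
  rwa [hfy]

theorem isBounded_fderiv_image_interior (hs : IsCompact s) (hf : ContDiffOn 𝕜 1 f s) :
    Bornology.IsBounded (fderiv 𝕜 f '' interior s) := by
  suffices h_inter : Bornology.IsBounded (fderiv 𝕜 f '' (s ∩ interior s)) by
    rwa [inter_eq_right.2 interior_subset] at h_inter
  refine hs.induction_on (p := fun t => Bornology.IsBounded (fderiv 𝕜 f '' (t ∩ interior s)))
    (by simp) (fun t u htu hu => hu.subset (by gcongr)) (fun t u ht hu => ?_)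
    fun x hx => exists_mem_nhdsWithin_isBounded_fderiv_image hx (hf x hx)
  simpa only [union_inter_distrib_right, image_union] using ht.union hu

end Derivative

section Jacobian

variable {E : Type*} [NormedAddCommGroup E] [NormedSpace ℝ E] [FiniteDimensional ℝ E]

theorem exists_abs_det_fderiv_le {f : E → E} {s : Set E} (hs : IsCompact s)
    (hf : ContDiffOn ℝ 1 f s) : ∃ M : ℝ≥0, ∀ x ∈ interior s, |(fderiv ℝ f x).det| ≤ M := by
  have : ProperSpace (E →L[ℝ] E) := FiniteDimensional.proper ℝ _
  obtain ⟨M, hM⟩ := (isBounded_fderiv_image_interior hs hf).isCompact_closure.bddAbove_image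
    ContinuousLinearMap.continuous_det.abs.continuousOn
  exact ⟨M.toNNReal, fun x hx =>
    (hM ⟨_, subset_closure ⟨x, hx, rfl⟩, rfl⟩).trans (Real.le_coe_toNNReal M)⟩

variable [MeasurableSpace E] [BorelSpace E] (μ : Measure E) [μ.IsAddHaarMeasure]
  {f : E → E} {f' : E → E →L[ℝ] E} {s : Set E} {M : ℝ≥0}

theorem restrict_image_le_smul_map (hs : MeasurableSet s)
    (hf' : ∀ x ∈ s, HasFDerivWithinAt f (f' x) s x) (hM : ∀ x ∈ s, |(f' x).det| ≤ M) :
    μ.restrict (f '' s) ≤ (M : ℝ≥0∞) • (μ.restrict s).map f := by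
  have hcont : ContinuousOn f s := fun x hx => (hf' x hx).continuousWithinAt
  refine Measure.le_iff.2 fun A hA => ?_
  have hmeas : MeasurableSet (s ∩ f ⁻¹' A) := by
    have h := hs.subtype_image (hcont.domRestrict.measurable hA)
    rwa [domRestrict_eq, preimage_comp, Subtype.image_preimage_coe] at h
  calc μ.restrict (f '' s) A = μ (f '' (s ∩ f ⁻¹' A)) := by
        rw [Measure.restrict_apply hA, image_inter_preimage, inter_comm]
    _ ≤ ∫⁻ x in s ∩ f ⁻¹' A, ENNReal.ofReal |(f' x).det| ∂μ :=
        addHaar_image_le_lintegral_abs_det_fderiv μ hmeas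
          fun x hx => (hf' x hx.1).mono inter_subset_left
    _ ≤ ∫⁻ _ in s ∩ f ⁻¹' A, (M : ℝ≥0∞) ∂μ :=
        setLIntegral_mono measurable_const fun x hx => by
          simpa using ENNReal.ofReal_le_ofReal (hM x hx.1)
    _ = ((M : ℝ≥0∞) • (μ.restrict s).map f) A := by
        rw [setLIntegral_const, Measure.smul_apply, smul_eq_mul,
          Measure.map_apply_of_aemeasurable (hcont.aemeasurable hs) hA,
          Measure.restrict_apply' hs, inter_comm]

theorem eLpNorm_restrict_image_le {G : Type*} [NormedAddCommGroup G] {g : E → G} {p : ℝ≥0∞}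
    (hs : MeasurableSet s) (hf' : ∀ x ∈ s, HasFDerivWithinAt f (f' x) s x)
    (hM : ∀ x ∈ s, |(f' x).det| ≤ M) (hg : AEStronglyMeasurable g ((μ.restrict s).map f)) :
    eLpNorm g p (μ.restrict (f '' s)) ≤
      (M : ℝ≥0∞) ^ (1 / p).toReal * eLpNorm (g ∘ f) p (μ.restrict s) := by
  have hf : AEMeasurable f (μ.restrict s) :=
    ContinuousOn.aemeasurable (fun x hx => (hf' x hx).continuousWithinAt) hs
  rw [← eLpNorm_map_measure hg hf]
  exact eLpNorm_le_of_measure_le_smul (restrict_image_le_smul_map μ hs hf' hM)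

end Jacobian

theorem aestronglyMeasurable_map_of_continuousOn {X Y Z : Type*} [MeasurableSpace X]
    [TopologicalSpace Y] [MeasurableSpace Y] [OpensMeasurableSpace Y] [SecondCountableTopology Y]
    [TopologicalSpace Z] [TopologicalSpace.PseudoMetrizableSpace Z]
    {μ : Measure X} {φ : X → Y} {g : Y → Z} {t : Set Y} (hφ : AEMeasurable φ μ)
    (ht : MeasurableSet t) (hφt : ∀ᵐ x ∂μ, φ x ∈ t) (hg : ContinuousOn g t) :
    AEStronglyMeasurable g (μ.map φ) := by
  rw [← Measure.restrict_eq_self_of_ae_mem ((ae_map_iff hφ ht).2 hφt)]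
  exact hg.aestronglyMeasurable ht

theorem memLp_restrict_of_continuousOn_closure {X G : Type*} [PseudoMetricSpace X] [ProperSpace X]
    [MeasurableSpace X] [OpensMeasurableSpace X] [NormedAddCommGroup G] {μ : Measure X}
    [IsFiniteMeasureOnCompacts μ] {s : Set X} {f : X → G} {p : ℝ≥0∞}
    (hs : Bornology.IsBounded s) (hf : ContinuousOn f (closure s)) :
    MemLp f p (μ.restrict s) := by
  have hK : IsCompact (closure s) := hs.isCompact_closure
  have : IsFiniteMeasure (μ.restrict (closure s)) := ⟨by simpa using hK.measure_lt_top⟩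
  obtain ⟨C, hC⟩ := hK.exists_bound_of_continuousOn hf
  have hL : MemLp f p (μ.restrict (closure s)) :=
    .of_bound (hf.aestronglyMeasurable isClosed_closure.measurableSet) C
      ((ae_restrict_mem isClosed_closure.measurableSet).mono hC)
  exact hL.mono_measure (Measure.restrict_mono_set μ subset_closure)

variable {n : ℕ} {Ω : Set (Cn n)}

theorem antilipschitzWith_compositionOperator {φ : Cn n → Cn n} (hΩ : IsOpen Ω)
    (hφ : DifferentiableOn ℂ φ Ω) (hmaps : MapsTo φ Ω Ω) (h : ComposesBergman Ω φ)
    (hsurj : SurjOn φ Ω Ω) {M : ℝ≥0} (hM : ∀ z ∈ Ω, |(fderiv ℝ φ z).det| ≤ M) :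
    AntilipschitzWith (M ^ (1 / 2 : ℝ)) (compositionOperator hΩ hφ hmaps h) := by
  refine AddMonoidHomClass.antilipschitz_of_bound _ fun f => ?_
  have hφ' : ∀ z ∈ Ω, HasFDerivWithinAt φ (fderiv ℝ φ z) Ω z := fun z hz =>
    ((hφ.differentiableAt (hΩ.mem_nhds hz)).restrictScalars ℝ).hasFDerivAt.hasFDerivWithinAt
  have hmeas : AEStronglyMeasurable (holo f) ((volume.restrict Ω).map φ) :=
    aestronglyMeasurable_map_of_continuousOn (hφ.continuousOn.aemeasurable hΩ.measurableSet)
      hΩ.measurableSet ((ae_restrict_mem hΩ.measurableSet).mono hmaps)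
      (holo_differentiableOn f).continuousOn
  have hle : eLpNorm (holo f) 2 (volume.restrict Ω) ≤
      (M ^ (1 / 2 : ℝ) : ℝ≥0) * eLpNorm (holo f ∘ φ) 2 (volume.restrict Ω) := by
    have h_image := eLpNorm_restrict_image_le (p := 2) volume hΩ.measurableSet hφ' hM hmeas
    rw [hsurj.image_eq_of_mapsTo hmaps] at h_image
    simpa [ENNReal.coe_rpow_of_nonneg] using h_image
  change ‖(f : Lp ℂ 2 (volume.restrict Ω))‖ ≤ _ * ‖(h f).toLp (holo f ∘ φ)‖
  rw [Lp.norm_toLp, Lp.norm_def, eLpNorm_congr_ae (holo_ae_eq f), ← ENNReal.coe_toReal,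
    ← ENNReal.toReal_mul]
  exact ENNReal.toReal_mono (ENNReal.mul_ne_top ENNReal.coe_ne_top (h f).eLpNorm_ne_top) hle

theorem memLp_polynomial_eval_apply (hb : Bornology.IsBounded Ω) (i : Fin n) (p : ℂ[X]) :
    MemLp (fun z : Cn n => p.eval (z i)) 2 (volume.restrict Ω) :=
  memLp_restrict_of_continuousOn_closure hb (by fun_prop)

/-- The polynomials in the `i`-th coordinate, as elements of the Bergman space of a bounded set;
they witness that this space is infinite-dimensional. -/
noncomputable def bergmanPolynomial (hb : Bornology.IsBounded Ω) (i : Fin n) :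
    ℂ[X] →ₗ[ℂ] bergmanSpace Ω where
  toFun p := ⟨(memLp_polynomial_eval_apply hb i p).toLp _, fun z => p.eval (z i), by fun_prop,
    MemLp.coeFn_toLp _⟩
  map_add' p q := Subtype.ext <|
    (MemLp.toLp_congr (memLp_polynomial_eval_apply hb i _) _
      (.of_forall fun _ => Polynomial.eval_add)).trans
      (MemLp.toLp_add (memLp_polynomial_eval_apply hb i p) (memLp_polynomial_eval_apply hb i q))
  map_smul' c p := Subtype.ext <|
    (MemLp.toLp_congr (memLp_polynomial_eval_apply hb i _) _
      (.of_forall fun _ => Polynomial.eval_smul ..)).trans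
      (MemLp.toLp_const_smul c (memLp_polynomial_eval_apply hb i p))

theorem bergmanPolynomial_injective (ho : IsOpen Ω) (hne : Ω.Nonempty)
    (hb : Bornology.IsBounded Ω) (i : Fin n) : Function.Injective (bergmanPolynomial hb i) := by
  intro p q hpq
  have hae : (fun z : Cn n => p.eval (z i)) =ᵐ[volume.restrict Ω] fun z => q.eval (z i) :=
    (MemLp.toLp_eq_toLp_iff (memLp_polynomial_eval_apply hb i p)
      (memLp_polynomial_eval_apply hb i q)).1 (congrArg Subtype.val hpq)
  have heq : EqOn (fun z : Cn n => p.eval (z i)) (fun z => q.eval (z i)) Ω :=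
    Measure.eqOn_open_of_ae_eq hae ho (by fun_prop) (by fun_prop)
  have hinf : (Function.eval i '' Ω).Infinite := by
    obtain ⟨z, hz⟩ := hne
    exact infinite_of_mem_nhds (z i) ((isOpenMap_eval i Ω ho).mem_nhds ⟨z, hz, rfl⟩)
  exact Polynomial.eq_of_infinite_eval_eq p q
    (hinf.mono (image_subset_iff.2 fun z hz => heq hz))

theorem not_finiteDimensional_bergmanSpace (hn : 0 < n) (ho : IsOpen Ω) (hne : Ω.Nonempty)
    (hb : Bornology.IsBounded Ω) : ¬ FiniteDimensional ℂ (bergmanSpace Ω) :=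
  fun _ => Polynomial.not_finite (R := ℂ) <|
    Module.Finite.of_injective _ (bergmanPolynomial_injective ho hne hb ⟨0, hn⟩)

end CompOp

theorem corollary2_general {n : ℕ} (hn : 0 < n) {Ω : Set (CompOp.Cn n)} (hΩ_open : IsOpen Ω)
    (hΩ_nonempty : Ω.Nonempty) (hΩ_bounded : Bornology.IsBounded Ω)
    {φ : CompOp.Cn n → CompOp.Cn n} (hφ_maps : MapsTo φ Ω Ω) (hφ_holo : DifferentiableOn ℂ φ Ω)
    (hφ_surj : SurjOn φ Ω Ω) {M : ℝ≥0} (hM : ∀ z ∈ Ω, |(fderiv ℝ φ z).det| ≤ M) :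
    ¬ ∃ h : CompOp.ComposesBergman Ω φ,
        IsCompactOperator (CompOp.compositionOperator hΩ_open hφ_holo hφ_maps h) := by
  rintro ⟨h, hcompact⟩
  have hanti := CompOp.antilipschitzWith_compositionOperator hΩ_open hφ_holo hφ_maps h hφ_surj hM
  exact CompOp.not_finiteDimensional_bergmanSpace hn hΩ_open hΩ_nonempty hΩ_bounded
    (CompOp.finiteDimensional_of_isCompactOperator_of_antilipschitzWith hcompact hanti)

/- A bounded convex domain with smooth boundary and a holomorphic self-map `φ` of it that is `C¹` on
the closure (the values of `φ` on the boundary are those of the `C¹` extension). If `φ` is proper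
and surjective as a map `Ω → Ω`, it is not the case that `C_φ` maps `A²(Ω)` to itself and is
compact. -/
theorem corollary2 (n : ℕ) (hn : 2 ≤ n) (Ω : Set (CompOp.Cn n))
    (hΩ_open : IsOpen Ω) (hΩ_nonempty : Ω.Nonempty) (hΩ_bounded : Bornology.IsBounded Ω)
    (hΩ_convex : Convex ℝ Ω) (hΩ_smooth : CompOp.HasSmoothBoundary Ω)
    (φ : CompOp.Cn n → CompOp.Cn n) (hφ_maps : Set.MapsTo φ Ω Ω)
    (hφ_holo : DifferentiableOn ℂ φ Ω) (hφ_C1 : ContDiffOn ℝ 1 φ (closure Ω))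
    (hφ_proper : IsProperMap (Set.MapsTo.restrict φ Ω Ω hφ_maps))
    (hφ_surj : Function.Surjective (Set.MapsTo.restrict φ Ω Ω hφ_maps)) :
    ¬ ∃ h : CompOp.ComposesBergman Ω φ,
        IsCompactOperator (CompOp.compositionOperator hΩ_open hφ_holo hφ_maps h) := by
  obtain ⟨M, hM⟩ := CompOp.exists_abs_det_fderiv_le hΩ_bounded.isCompact_closure hφ_C1
  exact corollary2_general (by omega) hΩ_open hΩ_nonempty hΩ_bounded hφ_maps hφ_holo
    (hφ_maps.restrict_surjective_iff.1 hφ_surj)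
    fun z hz => hM z (hΩ_open.subset_interior_closure hz)
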